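/- All graphs are undirected, finite and simple. For a graph $G$ and a set $S\subseteq V(G)$, an $S$-tree is a subgraph $T$ of $G$ that is a tree with $S\subseteq V(T)$. $S$-trees $T_1,\dots,T_r$ are internally disjoint if $E(T_i)\cap E(T_j)=\emptyset$ and $V(T_i)\cap V(T_j)=S$ for all $1\le i<j\le r$. Let $\kappa(S)$ denote the greatest number of internally disjoint $S$-trees in $G$, and, for a graph $G$ with at least $3$ vertices, let $\kappa_3(G)=\min\{\kappa(S) : S\subseteq V(G),\ |S|=3\}$. Let $Q_n$ denote the $n$-dimensional hypercube: its vertices are the binary strings of length $n$, two of them being adjacent if and only if they differ in exactly one coordinate (equivalently, $Q_n$ is the Cartesian product of $n$ copies of the path $P_2$ on two vertices). **Corollary 3.1.** For every integer $n\ge 2$, $\kappa_3(Q_n)=n-1$. -/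

import Mathlib

namespace GenConn

/-- An `S`-tree of `G`: a subgraph of `G` that is a tree and whose vertex set contains `S`. -/
def IsSTree {V : Type*} (G : SimpleGraph V) (S : Finset V) (T : G.Subgraph) : Prop :=
  T.coe.IsTree ∧ (S : Set V) ⊆ T.verts

/-- A family of internally disjoint `S`-trees: any two of them share no edge, and the vertices
they share are exactly those of `S`. -/
def IsInternallyDisjoint {V : Type*} (G : SimpleGraph V) (S : Finset V) {r : ℕ}
    (T : Fin r → G.Subgraph) : Prop :=
  (∀ i, IsSTree G S (T i)) ∧
    ∀ i j, i ≠ j → (T i).edgeSet ∩ (T j).edgeSet = ∅ ∧ (T i).verts ∩ (T j).verts = (S : Set V)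

/-- `κ(S)`: the greatest number of internally disjoint `S`-trees in `G`. -/
noncomputable def kappaSet {V : Type*} (G : SimpleGraph V) (S : Finset V) : ℕ∞ :=
  ⨆ (r : ℕ) (_ : ∃ T : Fin r → G.Subgraph, IsInternallyDisjoint G S T), (r : ℕ∞)

open Classical in
/-- The generalized `k`-connectivity `κ_k(G)` (for `2 ≤ k`): the minimum of `κ(S)` over all sets
`S` of exactly `k` vertices. By convention a graph with fewer than `k` vertices has value `1` if it
is connected (and `0` if it is not). -/
noncomputable def kappa (k : ℕ) {V : Type*} (G : SimpleGraph V) : ℕ∞ :=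
  if ENat.card V < k then (if G.Connected then 1 else 0)
  else ⨅ (S : Finset V) (_ : S.card = k), kappaSet G S

/-- The `n`-dimensional hypercube: the vertices are the binary strings of length `n`, and two of
them are adjacent when they differ in exactly one coordinate. -/
def hypercube (n : ℕ) : SimpleGraph (Fin n → Bool) where
  Adj x y := ∃! i, x i ≠ y i
  symm := ⟨fun x y h => by simpa only [ne_comm] using h⟩
  loopless := ⟨fun x h => by obtain ⟨i, hi, -⟩ := h; exact hi rfl⟩

end GenConn

/-! Upper bound: take `u`, two of its neighbours, and suppose `n` trees exist. Degrees are `n`, so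
each edge at a terminal is the only edge there of some tree; the tree using an edge between two
terminals then has no way out to the third (`IsInternallyDisjoint.lt_of_adj`). Lower bound: some
coordinate `k` separates one terminal `x` from the other two, `y` and `z`. For each of the `n - 1`
directions `j ≠ k`, join `y` to `z` inside their half-cube by a path starting in direction `j`, copy
that start across `k`, and continue to `x` in the other half. Paths for distinct `j` meet only at
their ends (`cyclicPath_eq_end`). -/

namespace GenConn

open SimpleGraph

/-! ### Internally disjoint trees in a general graph. -/

section Trees

variable {V : Type*} {G : SimpleGraph V}

/-- A connected subgraph contains a spanning tree. -/
lemma exists_isTree_le_of_connected {H : G.Subgraph} (hH : H.Connected) :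
    ∃ T : G.Subgraph, T ≤ H ∧ T.verts = H.verts ∧ T.coe.IsTree := by
  obtain ⟨F, hF, hT⟩ := hH.coe.exists_isTree_le
  let T : G.Subgraph :=
    { verts := H.verts
      Adj := fun a b => ∃ (ha : a ∈ H.verts) (hb : b ∈ H.verts), F.Adj ⟨a, ha⟩ ⟨b, hb⟩
      adj_sub := fun ⟨_, _, h⟩ => H.adj_sub (hF h)
      edge_vert := fun ⟨ha, _, _⟩ => ha
      symm := ⟨fun _ _ ⟨ha, hb, h⟩ => ⟨hb, ha, h.symm⟩⟩ }
  have hTF : T.coe = F := by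
    ext ⟨a, ha⟩ ⟨b, hb⟩
    exact ⟨fun ⟨_, _, h⟩ => h, fun h => ⟨ha, hb, h⟩⟩
  exact ⟨T, ⟨le_rfl, fun _ _ ⟨_, _, h⟩ => hF h⟩, rfl, hTF ▸ hT⟩

/-- Connected subgraphs that are internally disjoint contain internally disjoint trees. -/
lemma le_kappaSet_of_connected {S : Finset V} {r : ℕ} (H : Fin r → G.Subgraph)
    (hconn : ∀ i, (H i).Connected) (hS : ∀ i, (S : Set V) ⊆ (H i).verts)
    (hadj : ∀ i j, i ≠ j → ∀ a b, (H i).Adj a b → ¬ (H j).Adj a b)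
    (hverts : ∀ i j, i ≠ j → (H i).verts ∩ (H j).verts ⊆ S) :
    (r : ℕ∞) ≤ kappaSet G S := by
  choose T hle hv hT using fun i => exists_isTree_le_of_connected (hconn i)
  refine le_iSup₂_of_le r ⟨T, fun i => ⟨hT i, by rw [hv]; exact hS i⟩, fun i j hij => ⟨?_, ?_⟩⟩ le_rfl
  · refine Set.eq_empty_of_forall_notMem fun e => ?_
    induction e with
    | _ a b => exact fun h => hadj i j hij a b ((hle i).2 h.1) ((hle j).2 h.2)
  · rw [hv, hv]
    exact (hverts i j hij).antisymm (Set.subset_inter (hS i) (hS j))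

/-- A connected subgraph meeting both `A` and its complement has an edge leaving `A`. -/
lemma exists_adj_of_connected {H : G.Subgraph} (hH : H.coe.Connected) {A : Set V} {a b : V}
    (ha : a ∈ H.verts) (hb : b ∈ H.verts) (haA : a ∈ A) (hbA : b ∉ A) :
    ∃ c d, c ∈ A ∧ d ∉ A ∧ H.Adj c d := by
  obtain ⟨p⟩ := hH.preconnected ⟨a, ha⟩ ⟨b, hb⟩
  obtain ⟨d, -, h1, h2⟩ := p.exists_boundary_dart (Subtype.val ⁻¹' A) haA hbA
  exact ⟨_, _, h1, h2, d.adj⟩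

lemma IsInternallyDisjoint.eq_of_adj {S : Finset V} {r : ℕ} {T : Fin r → G.Subgraph}
    (hT : IsInternallyDisjoint G S T) {i j : Fin r} {a b : V} (hi : (T i).Adj a b)
    (hj : (T j).Adj a b) : i = j := by
  by_contra hij
  have h : s(a, b) ∈ (T i).edgeSet ∩ (T j).edgeSet := ⟨hi, hj⟩
  rw [(hT.2 i j hij).1] at h
  exact h

/-- If there are at least as many trees as edges at a terminal `u`, then every edge at `u` is the
only edge at `u` of some tree. -/
lemma IsInternallyDisjoint.exists_adj_unique {S : Finset V} {r : ℕ} {T : Fin r → G.Subgraph}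
    (hT : IsInternallyDisjoint G S T) {u w : V} (hu : u ∈ S) (hw : w ∈ S) (huw : w ≠ u)
    [Finite (G.neighborSet u)] (hdeg : Nat.card (G.neighborSet u) ≤ r) {b : V} (hb : G.Adj u b) :
    ∃ i, (T i).Adj u b ∧ ∀ c, (T i).Adj u c → c = b := by
  have key : ∀ i, ∃ c, (T i).Adj u c := fun i => by
    obtain ⟨c, d, rfl, -, h⟩ := exists_adj_of_connected (A := {u}) (hT.1 i).1.1
      ((hT.1 i).2 hu) ((hT.1 i).2 hw) rfl huw
    exact ⟨d, h⟩
  choose f hf using key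
  let g : Fin r → G.neighborSet u := fun i => ⟨f i, (T i).adj_sub (hf i)⟩
  have hg : Function.Injective g := fun i j hij => by
    have h : f i = f j := congrArg Subtype.val hij
    exact hT.eq_of_adj (hf i) (h ▸ hf j)
  -- The trees use distinct edges at `u` and are at least as many as these edges, so each tree has
  -- exactly one.
  have hbij := hg.bijective_of_nat_card_le (by simpa using hdeg)
  have hsurj : ∀ c, G.Adj u c → ∃ i, f i = c := fun c hc => by
    obtain ⟨i, hi⟩ := hbij.2 ⟨c, hc⟩
    exact ⟨i, congrArg Subtype.val hi⟩
  obtain ⟨i, rfl⟩ := hsurj b hb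
  refine ⟨i, hf i, fun c hc => ?_⟩
  obtain ⟨j, rfl⟩ := hsurj c ((T i).adj_sub hc)
  rw [hT.eq_of_adj hc (hf j)]

/-- Two adjacent terminals of degree at most `n` and a third terminal do not admit `n` internally
disjoint trees. -/
lemma IsInternallyDisjoint.lt_of_adj {S : Finset V} {r n : ℕ} {T : Fin r → G.Subgraph}
    (hT : IsInternallyDisjoint G S T) {u v w : V} (hu : u ∈ S) (hv : v ∈ S) (hw : w ∈ S)
    (hwu : w ≠ u) (hwv : w ≠ v) (huv : G.Adj u v)
    [Finite (G.neighborSet u)] [Finite (G.neighborSet v)]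
    (hdu : Nat.card (G.neighborSet u) ≤ n) (hdv : Nat.card (G.neighborSet v) ≤ n) : r < n := by
  by_contra! hr
  obtain ⟨i, hi, hi'⟩ := hT.exists_adj_unique hu hw hwu (hdu.trans hr) huv
  obtain ⟨j, hj, hj'⟩ := hT.exists_adj_unique hv hw hwv (hdv.trans hr) huv.symm
  obtain rfl := hT.eq_of_adj hi hj.symm
  -- The edge `uv` is the only edge of tree `i` at either end, yet the tree must leave `{u, v}` to
  -- reach `w`.
  obtain ⟨c, d, hc, hd, hcd⟩ := exists_adj_of_connected (A := {u, v}) (hT.1 i).1.1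
    ((hT.1 i).2 hu) ((hT.1 i).2 hw) (by simp) (by simp [hwu, hwv])
  obtain rfl | rfl := hc
  · exact hd (by simp [hi' d hcd])
  · exact hd (by simp [hj' d hcd])

/-- A sequence whose consecutive terms are equal or adjacent spans a connected subgraph. -/
lemma connected_induce_range {f : ℕ → V} (hf : ∀ t, f t = f (t + 1) ∨ G.Adj (f t) (f (t + 1))) :
    ((⊤ : G.Subgraph).induce (Set.range f)).Connected := by
  rw [← connected_induce_iff]
  have h : ∀ t, (G.induce (Set.range f)).Reachable ⟨f 0, 0, rfl⟩ ⟨f t, t, rfl⟩ := fun t => by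
    induction t with
    | zero => exact Reachable.refl _
    | succ t ih =>
      refine ih.trans ?_
      obtain h | h := hf t
      · rw! [h]
        exact Reachable.refl _
      · exact Adj.reachable (by simpa using h)
  refine (connected_iff_exists_forall_reachable _).2 ⟨⟨f 0, 0, rfl⟩, ?_⟩
  rintro ⟨_, t, rfl⟩
  exact h t

end Trees

/-! ### Paths and trees in the hypercube. -/

section Hypercube

variable {n : ℕ}

lemma hypercube_adj_of_forall {x y : Fin n → Bool} {k : Fin n} (hk : x k ≠ y k)
    (h : ∀ i, i ≠ k → x i = y i) : (hypercube n).Adj x y :=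
  ⟨k, hk, fun i hi => by_contra fun hik => hi (h i hik)⟩

/-- The vertex obtained from `x` by changing coordinate `k`. -/
def flip (x : Fin n → Bool) (k : Fin n) : Fin n → Bool := Function.update x k (!x k)

@[simp] lemma flip_self (x : Fin n → Bool) (k : Fin n) : flip x k k = !x k := by simp [flip]

lemma flip_of_ne (x : Fin n → Bool) {i k : Fin n} (h : i ≠ k) : flip x k i = x i := by
  simp [flip, h]

lemma hypercube_adj_flip (x : Fin n → Bool) (k : Fin n) : (hypercube n).Adj x (flip x k) :=
  hypercube_adj_of_forall (k := k) (by simp) fun _ h => (flip_of_ne x h).symm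

lemma flip_injective (x : Fin n → Bool) : Function.Injective (flip x) := fun i j h => by
  by_contra hij
  have := congrFun h i
  simp [flip_of_ne x hij] at this

lemma card_neighborSet_hypercube_le (x : Fin n → Bool) :
    Nat.card ((hypercube n).neighborSet x) ≤ n := by
  have h : ∀ y : (hypercube n).neighborSet x, ∃ k, flip x k = y := by
    rintro ⟨y, k, hk, hk'⟩
    refine ⟨k, funext fun i => ?_⟩
    by_cases hi : i = k
    · subst hi
      simpa using (Bool.eq_not_of_ne (Ne.symm hk)).symm
    · rw [flip_of_ne x hi]
      exact by_contra fun h => hi (hk' i h)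
  choose f hf using h
  have hinj : Function.Injective f := fun a b hab => Subtype.ext (by rw [← hf a, ← hf b, hab])
  simpa using Nat.card_le_card_of_injective f hinj

/-- The position of coordinate `i` in the cyclic order of the coordinates that starts at `j`. -/
def cyclicPos (j i : Fin n) : ℕ := if j ≤ i then (i : ℕ) - j else i + n - j

lemma cyclicPos_lt (j i : Fin n) : cyclicPos j i < n := by
  unfold cyclicPos; grind

lemma cyclicPos_self (j : Fin n) : cyclicPos j j = 0 := by simp [cyclicPos]

lemma cyclicPos_injective (j : Fin n) : Function.Injective (cyclicPos j) := fun a b h => by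
  unfold cyclicPos at h; grind

/-- From `u`, change coordinate `j`; then, in the cyclic order starting at `j`, change each other
coordinate into that of `v`; finally do this for coordinate `j`. This describes `n` paths from `u`
to `v` that are disjoint except at their ends. -/
def cyclicPath (u v : Fin n → Bool) (j : Fin n) (t : ℕ) : Fin n → Bool := fun i =>
  -- Positions are below `n`, so at time `n` only coordinate `j` can still differ from `v`; it is
  -- settled at time `n + 1`.
  if i = j ∧ t ≤ n then !u i else if cyclicPos j i < t then v i else u i

variable {u v : Fin n → Bool}

lemma cyclicPath_zero (u v : Fin n → Bool) (j : Fin n) : cyclicPath u v j 0 = flip u j := by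
  funext i
  by_cases h : i = j
  · subst h; simp [cyclicPath]
  · simp [cyclicPath, h, flip_of_ne]

lemma cyclicPath_of_lt (u v : Fin n → Bool) (j : Fin n) {t : ℕ} (ht : n < t) :
    cyclicPath u v j t = v := by
  funext i
  simp [cyclicPath, ht.not_ge, (cyclicPos_lt j i).trans ht]

lemma cyclicPath_apply_of_eq {j k : Fin n} (hk : k ≠ j) (h : u k = v k) (t : ℕ) :
    cyclicPath u v j t k = u k := by
  simp [cyclicPath, hk, h]

lemma cyclicPath_step (u v : Fin n → Bool) (j : Fin n) (t : ℕ) :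
    cyclicPath u v j t = cyclicPath u v j (t + 1) ∨
      (hypercube n).Adj (cyclicPath u v j t) (cyclicPath u v j (t + 1)) := by
  have key : ∃ k : Fin n, ∀ i, i ≠ k →
      cyclicPath u v j t i = cyclicPath u v j (t + 1) i := by
    -- Step `t` touches only the coordinate in position `t`; if there is none other than `j`, only
    -- `j` itself can change.
    by_cases h : ∃ k, k ≠ j ∧ cyclicPos j k = t
    · obtain ⟨k, hkj, rfl⟩ := h
      refine ⟨k, fun i hi => ?_⟩
      have h1 := (cyclicPos_injective j).ne hi
      have h2 := cyclicPos_lt j k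
      unfold cyclicPath
      grind
    · refine ⟨j, fun i hi => ?_⟩
      have h1 : cyclicPos j i ≠ t := fun h' => h ⟨i, hi, h'⟩
      unfold cyclicPath
      grind
  obtain ⟨k, hk⟩ := key
  by_cases h : cyclicPath u v j t k = cyclicPath u v j (t + 1) k
  · left
    funext i
    by_cases hi : i = k
    · rw [hi, h]
    · exact hk i hi
  · exact .inr (hypercube_adj_of_forall h hk)

lemma cyclicPath_ne_start (h : u ≠ v) (j : Fin n) (t : ℕ) : cyclicPath u v j t ≠ u := by
  intro heq
  by_cases ht : t ≤ n
  · have := congrFun heq j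
    simp [cyclicPath, ht] at this
  · rw [cyclicPath_of_lt u v j (not_le.1 ht)] at heq
    exact h heq.symm

/-- Before its last step, path `i` has coordinate `i` flipped, so path `j` must already have passed
`i`, with `v i = !u i`; likewise path `i` has passed `j`. The two cyclic intervals passed then cover
all coordinates, so every one agrees with `v`. -/
lemma cyclicPath_eq_end {i j : Fin n} (hij : i ≠ j) {s t : ℕ}
    (h : cyclicPath u v i s = cyclicPath u v j t) : cyclicPath u v i s = v := by
  wlog hlt : i < j generalizing i j s t
  · rw [h]
    exact this hij.symm h.symm (lt_of_le_of_ne (not_lt.1 hlt) hij.symm)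
  by_cases hs : n < s
  · exact cyclicPath_of_lt u v i hs
  by_cases ht : n < t
  · rw [h, cyclicPath_of_lt u v j ht]
  have hi := congrFun h i
  have hj := congrFun h j
  funext k
  have hk := congrFun h k
  simp only [cyclicPath, cyclicPos] at hi hj hk ⊢
  grind

/-- The connected subgraph made of the path from `y` to `z` and of the path from the copy of `y`
across coordinate `k` to `x`, both starting in direction `j`, joined across coordinate `k`. -/
def hypercubeTree (x y z : Fin n → Bool) (k j : Fin n) : (hypercube n).Subgraph :=
  (hypercube n).subgraphOfAdj (hypercube_adj_flip y j) ⊔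
    (⊤ : (hypercube n).Subgraph).induce (Set.range (cyclicPath y z j)) ⊔
    (⊤ : (hypercube n).Subgraph).induce (Set.range (cyclicPath (flip y k) x j)) ⊔
    (hypercube n).subgraphOfAdj (hypercube_adj_flip (flip y j) k)

section

variable {x y z : Fin n → Bool} {k j : Fin n}

lemma flip_comm (x : Fin n → Bool) (i j : Fin n) : flip (flip x i) j = flip (flip x j) i := by
  funext l
  simp only [flip, Function.update_apply]
  grind

lemma flip_mem_range_cyclicPath (u v : Fin n → Bool) (j : Fin n) :
    flip u j ∈ Set.range (cyclicPath u v j) :=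
  ⟨0, cyclicPath_zero u v j⟩

lemma end_mem_range_cyclicPath (u v : Fin n → Bool) (j : Fin n) :
    v ∈ Set.range (cyclicPath u v j) :=
  ⟨n + 1, cyclicPath_of_lt u v j n.lt_succ_self⟩

lemma mem_verts_hypercubeTree {a : Fin n → Bool} :
    a ∈ (hypercubeTree x y z k j).verts ↔ a = y ∨ a ∈ Set.range (cyclicPath y z j) ∨
      a ∈ Set.range (cyclicPath (flip y k) x j) := by
  have h1 := flip_mem_range_cyclicPath y z j
  have h2 := flip_mem_range_cyclicPath (flip y k) x j
  rw [flip_comm] at h2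
  simp only [hypercubeTree, Subgraph.verts_sup, Subgraph.induce_verts, subgraphOfAdj_verts,
    Set.mem_union, Set.mem_insert_iff, Set.mem_singleton_iff]
  grind

lemma hypercubeTree_connected : (hypercubeTree x y z k j).Connected := by
  have h1 := flip_mem_range_cyclicPath y z j
  have h2 := flip_mem_range_cyclicPath (flip y k) x j
  rw [flip_comm] at h2
  have hp := connected_induce_range (cyclicPath_step y z j)
  have hq := connected_induce_range (cyclicPath_step (flip y k) x j)
  have he := Subgraph.subgraphOfAdj_connected (hypercube_adj_flip y j)
  have hc := Subgraph.subgraphOfAdj_connected (hypercube_adj_flip (flip y j) k)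
  have h3 := Subgraph.connected_sup he.preconnected hp.preconnected ⟨flip y j, by simp, h1⟩
  have h4 := Subgraph.connected_sup hc.preconnected hq.preconnected
    ⟨flip (flip y j) k, by simp, h2⟩
  have h5 := Subgraph.connected_sup h3.preconnected h4.preconnected ⟨flip y j, by simp, by simp⟩
  convert h5 using 1
  rw [hypercubeTree, sup_assoc, sup_comm ((⊤ : (hypercube n).Subgraph).induce
    (Set.range (cyclicPath (flip y k) x j)))]

/-- Coordinate `k` is constant on each path, so paths in opposite halves never meet; within one half
`cyclicPath_eq_end` applies. -/
lemma verts_inter_hypercubeTree (hyz : y k = z k) (hxy : x k ≠ y k) {i j : Fin n} (hi : i ≠ k)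
    (hj : j ≠ k) (hij : i ≠ j) {a : Fin n → Bool} (hai : a ∈ (hypercubeTree x y z k i).verts)
    (haj : a ∈ (hypercubeTree x y z k j).verts) : a = x ∨ a = y ∨ a = z := by
  have hx : flip y k k = x k := by rw [flip_self]; exact (Bool.eq_not_of_ne hxy).symm
  rw [mem_verts_hypercubeTree] at hai haj
  obtain rfl | ⟨s, rfl⟩ | ⟨s, rfl⟩ := hai
  · simp
  · obtain h | ⟨t, ht⟩ | ⟨t, ht⟩ := haj
    · simp [h]
    · exact .inr (.inr (cyclicPath_eq_end hij ht.symm))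
    · have := congrFun ht k
      rw [cyclicPath_apply_of_eq hj.symm hx, cyclicPath_apply_of_eq hi.symm hyz, hx] at this
      exact absurd this hxy
  · obtain h | ⟨t, ht⟩ | ⟨t, ht⟩ := haj
    · simp [h]
    · have := congrFun ht k
      rw [cyclicPath_apply_of_eq hi.symm hx, cyclicPath_apply_of_eq hj.symm hyz, hx] at this
      exact absurd this.symm hxy
    · exact .inl (cyclicPath_eq_end hij ht.symm)

/-- The only terminal on the first path is `z`, and on the second `x`, so the induced parts
contribute no edge between terminals. -/
lemma hypercubeTree_adj_terminals (hyz : y k = z k) (hxy : x k ≠ y k) (hne : y ≠ z)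
    (hj : j ≠ k) {a b : Fin n → Bool} (ha : a = x ∨ a = y ∨ a = z) (hb : b = x ∨ b = y ∨ b = z)
    (h : (hypercubeTree x y z k j).Adj a b) :
    s(y, flip y j) = s(a, b) ∨ s(flip y j, flip (flip y j) k) = s(a, b) := by
  have hx : flip y k k = x k := by rw [flip_self]; exact (Bool.eq_not_of_ne hxy).symm
  have hp : ∀ c, (c = x ∨ c = y ∨ c = z) → c ∈ Set.range (cyclicPath y z j) → c = z := by
    rintro c hc ⟨t, rfl⟩
    have h1 := cyclicPath_apply_of_eq hj.symm hyz t
    have h2 := cyclicPath_ne_start hne j t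
    obtain h | h | h := hc
    · rw [h] at h1; exact absurd h1 hxy
    · exact absurd h h2
    · exact h
  have hq : ∀ c, (c = x ∨ c = y ∨ c = z) → c ∈ Set.range (cyclicPath (flip y k) x j) → c = x := by
    rintro c hc ⟨t, rfl⟩
    have h1 := cyclicPath_apply_of_eq hj.symm hx t
    rw [hx] at h1
    obtain h | h | h := hc
    · exact h
    · rw [h] at h1; exact absurd h1.symm hxy
    · rw [h, ← hyz] at h1; exact absurd h1.symm hxy
  have hab := ((hypercubeTree x y z k j).adj_sub h).ne
  simp only [hypercubeTree, Subgraph.sup_adj, Subgraph.induce_adj, subgraphOfAdj_adj] at h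
  obtain ((h | h) | h) | h := h
  · exact .inl h
  · exact absurd ((hp a ha h.1).trans (hp b hb h.2.1).symm) hab
  · exact absurd ((hq a ha h.1).trans (hq b hb h.2.1).symm) hab
  · exact .inr h

/-- The ends of a shared edge are shared vertices, hence terminals. The edge is therefore an initial
or a crossing edge of both trees; coordinate `k` tells these kinds apart, and either kind determines
the direction. -/
lemma hypercubeTree_adj_disjoint (hyz : y k = z k) (hxy : x k ≠ y k) (hne : y ≠ z) {i j : Fin n}
    (hi : i ≠ k) (hj : j ≠ k) (hij : i ≠ j) {a b : Fin n → Bool}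
    (hai : (hypercubeTree x y z k i).Adj a b) : ¬ (hypercubeTree x y z k j).Adj a b := by
  intro haj
  have ha := verts_inter_hypercubeTree hyz hxy hi hj hij hai.fst_mem haj.fst_mem
  have hb := verts_inter_hypercubeTree hyz hxy hi hj hij hai.snd_mem haj.snd_mem
  have h1 := hypercubeTree_adj_terminals hyz hxy hne hi ha hb hai
  have h2 := hypercubeTree_adj_terminals hyz hxy hne hj ha hb haj
  have h0 : flip y i ≠ flip y j := (flip_injective y).ne hij
  have hi0 : y ≠ flip y i := (hypercube_adj_flip y i).ne
  have hj0 : y ≠ flip y j := (hypercube_adj_flip y j).ne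
  have hki := flip_of_ne y hi.symm
  have hkj := flip_of_ne y hj.symm
  have hki' := flip_self (flip y i) k
  have hkj' := flip_self (flip y j) k
  simp only [Sym2.eq_iff] at h1 h2
  clear ha hb hai haj
  obtain (⟨rfl, rfl⟩ | ⟨rfl, rfl⟩) | ⟨rfl, rfl⟩ | ⟨rfl, rfl⟩ := h1 <;>
    obtain (⟨h3, h4⟩ | ⟨h3, h4⟩) | ⟨h3, h4⟩ | ⟨h3, h4⟩ := h2 <;>
    have h5 := congrFun h3 k <;> have h6 := congrFun h4 k <;> grind -ext

end

/-- Any three vertices of the `(m + 1)`-cube are joined by `m` internally disjoint trees. -/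
lemma le_kappaSet_hypercube {m : ℕ} {S : Finset (Fin (m + 1) → Bool)} (hS : S.card = 3) :
    (m : ℕ∞) ≤ kappaSet (hypercube (m + 1)) S := by
  obtain ⟨x, y, z, k, hyz, hxy, hne, rfl⟩ : ∃ (x y z : Fin (m + 1) → Bool) (k : Fin (m + 1)),
      y k = z k ∧ x k ≠ y k ∧ y ≠ z ∧ S = {x, y, z} := by
    obtain ⟨a, b, c, hab, hac, hbc, rfl⟩ := Finset.card_eq_three.1 hS
    obtain ⟨k, hk⟩ := Function.ne_iff.1 hab
    -- Coordinates take two values, so `c` agrees at `k` with `a` or with `b`; the remaining one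
    -- plays `x`.
    by_cases h : b k = c k
    · exact ⟨a, b, c, k, h, hk, hbc, rfl⟩
    · exact ⟨b, a, c, k, by revert hk h; cases a k <;> cases b k <;> cases c k <;> simp, hk.symm, hac, Finset.insert_comm ..⟩
  refine le_kappaSet_of_connected (fun i => hypercubeTree x y z k (k.succAbove i))
    (fun i => hypercubeTree_connected) (fun i a ha => ?_) (fun i j hij a b => ?_)
    (fun i j hij a ha => ?_)
  · have h1 := end_mem_range_cyclicPath y z (k.succAbove i)
    have h2 := end_mem_range_cyclicPath (flip y k) x (k.succAbove i)
    simp only [Finset.coe_insert, Finset.coe_singleton, Set.mem_insert_iff,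
      Set.mem_singleton_iff] at ha
    rw [mem_verts_hypercubeTree]
    grind
  · exact hypercubeTree_adj_disjoint hyz hxy hne (Fin.succAbove_ne k i) (Fin.succAbove_ne k j)
      (Fin.succAbove_right_injective.ne hij)
  · simpa using verts_inter_hypercubeTree hyz hxy (Fin.succAbove_ne k i) (Fin.succAbove_ne k j)
      (Fin.succAbove_right_injective.ne hij) ha.1 ha.2

/-- Some three vertices of the `(m + 1)`-cube are joined by at most `m` internally disjoint
trees. -/
lemma exists_kappaSet_hypercube_le {m : ℕ} (hm : 1 ≤ m) :
    ∃ S : Finset (Fin (m + 1) → Bool), S.card = 3 ∧ kappaSet (hypercube (m + 1)) S ≤ m := by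
  let u : Fin (m + 1) → Bool := fun _ => false
  have hl : (0 : Fin (m + 1)) ≠ Fin.last m := by
    simp [Fin.ext_iff]
    lia
  have h1 : u ≠ flip u 0 := (hypercube_adj_flip u 0).ne
  have h2 : u ≠ flip u (Fin.last m) := (hypercube_adj_flip u _).ne
  have h3 : flip u 0 ≠ flip u (Fin.last m) := (flip_injective u).ne hl
  refine ⟨{u, flip u 0, flip u (Fin.last m)}, Finset.card_eq_three.2 ⟨_, _, _, h1, h2, h3, rfl⟩,
    iSup₂_le ?_⟩
  rintro r ⟨T, hT⟩
  have := hT.lt_of_adj (u := u) (v := flip u 0) (w := flip u (Fin.last m)) (by simp) (by simp)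
    (by simp) h2.symm h3.symm (hypercube_adj_flip u 0) (card_neighborSet_hypercube_le _)
    (card_neighborSet_hypercube_le _)
  exact_mod_cast Nat.le_of_lt_succ this

end Hypercube

end GenConn

theorem corollary3p1 (n : ℕ) (hn : 2 ≤ n) :
    GenConn.kappa 3 (GenConn.hypercube n) = ((n - 1 : ℕ) : ℕ∞) := by
  obtain ⟨m, rfl⟩ : ∃ m, n = m + 1 := ⟨n - 1, by lia⟩
  -- There are at least four vertices, so the convention for small graphs in `kappa` does not apply.
  have hcard : ¬ ENat.card (Fin (m + 1) → Bool) < (3 : ℕ) := by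
    have h : 2 ^ 2 ≤ 2 ^ (m + 1) := Nat.pow_le_pow_right two_pos hn
    rw [ENat.card_eq_coe_fintype_card, Nat.cast_lt]
    simp only [Fintype.card_fun, Fintype.card_bool, Fintype.card_fin]
    lia
  rw [GenConn.kappa, if_neg hcard, Nat.add_sub_cancel]
  refine le_antisymm ?_ (le_iInf₂ fun S hS => GenConn.le_kappaSet_hypercube hS)
  obtain ⟨S, hS, hle⟩ := GenConn.exists_kappaSet_hypercube_le (m := m) (by lia)
  exact (iInf₂_le S hS).trans hle
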